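/- Let $\mathbb{N}=\{0,1,2,\dots\}$. Let $\delta=(\alpha,\beta,\gamma)$ be a triple consisting of an infinite word $\alpha=\alpha_0\alpha_1\alpha_2\cdots$ over the alphabet $\{0,1,2,3\}$, a bond-set $\beta$ (a symmetric subset of $\{(x,y)\in\mathbb{N}^2 : |x-y|>1\}$), and an infinite binary word $\gamma=\gamma_0\gamma_1\gamma_2\cdots$. Let $\mathcal{P}^\delta$ be the infinite simple graph with vertices $v_{i,j}$ ($i,j\in\mathbb{N}$; $i$ is the column, $j$ the row) and exactly the following edges: (a) $v_{i,j}\sim v_{i+1,k}$ whenever $\alpha_i=0$ and $j=k$; or $\alpha_i=1$ and $j\ne k$; or $\alpha_i=2$ and $j\ge k$; or $\alpha_i=3$ and $j<k$; (b) $v_{i,x}\sim v_{j,y}$ for all $x,y\in\mathbb{N}$ whenever $(i,j)\in\beta$; (c) $v_{i,j}\sim v_{i,k}$ for all $j\neq k$ whenever $\gamma_i=1$. Let $\mathcal{G}^\delta$ be the hereditary class of all finite induced subgraphs of $\mathcal{P}^\delta$. The clique-width of a finite non-empty graph $G$ is the least number of labels needed to construct $G$ by the operations: creating a new vertex with a label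 $i$; adding all edges between vertices labelled $i$ and vertices labelled $j$, for distinct $i,j$; relabelling all vertices labelled $i$ to $j$; and taking the disjoint union of two labelled graphs already constructed (the empty graph has clique-width $0$). The class $\mathcal{G}^\delta$ has unbounded clique-width if for every $k$ it contains a graph of clique-width greater than $k$. For a finite set $Q\subseteq\mathbb{N}$ let $R_1(Q)=\{v_{i,0}:i\in Q\}$ and $R_2(Q)=\{v_{i,1}:i\in Q\}$ be the parts of the first two rows in the columns of $Q$, let $T^\delta(Q)$ be the subgraph of $\mathcal{P}^\delta$ induced on $R_1(Q)\cup R_2(Q)$, and let $\mathcal{N}^\delta(Q)$ be the number of equivalence classes of $R_1(Q)$ under the relation "having the same neighbourhood in $R_2(Q)$ in the graph $T^\delta(Q)$". Say that $\mathcal{N}^\delta$ is unbounded if there is a fixed $j\in\mathbb{N}$ such that $\mathcal{N}^\delta(\{j,j+1,\dots,n\})$ is unbounded as $n\to\infty$. Then, for every such triple $\delta$, the class $\mathcal{G}^\delta$ has unbounded clique-width if and only if $\mathcal{N}^\delta$ is unbounded. -/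

import Mathlib

namespace GridCW

/-! ### The grid graphs and their hereditary classes

Columns, rows and letters are numbered from `0`. -/

/-- A bond-set: a symmetric set of pairs `(x, y)` of natural numbers with `|x - y| > 1`. -/
structure BondSet where
  carrier : Set (ℕ × ℕ)
  symm : ∀ x y : ℕ, (x, y) ∈ carrier → (y, x) ∈ carrier
  separated : ∀ x y : ℕ, (x, y) ∈ carrier → 1 < |(x : ℤ) - (y : ℤ)|

/-- A triple `(α, β, γ)`: an infinite word over `{0,1,2,3}`, a bond-set, an infinite binary
word. -/
structure Triple where
  α : ℕ → Fin 4
  β : BondSet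
  γ : ℕ → Fin 2

/-- `linkAdj a j k`: with the letter `a`, the vertex in row `j` of a column is joined to the vertex
in row `k` of the next column. -/
def linkAdj : Fin 4 → ℕ → ℕ → Prop
  | 0, j, k => j = k
  | 1, j, k => j ≠ k
  | 2, j, k => k ≤ j
  | 3, j, k => j < k

/-- The edges of the infinite grid graph, each listed in at least one direction; `(i, j)` is the
vertex in column `i` and row `j`. -/
def gridRel (δ : Triple) (u v : ℕ × ℕ) : Prop :=
  (v.1 = u.1 + 1 ∧ linkAdj (δ.α u.1) u.2 v.2) ∨
  (u.1, v.1) ∈ δ.β.carrier ∨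
  (u.1 = v.1 ∧ δ.γ u.1 = 1)

/-- The infinite graph `P^δ`. (`fromRel` symmetrises the relation and removes loops.) -/
def gridGraph (δ : Triple) : SimpleGraph (ℕ × ℕ) :=
  SimpleGraph.fromRel (gridRel δ)

/-- A class of graphs. -/
def GraphClass : Type 1 := ∀ V : Type, SimpleGraph V → Prop

/-- The class `G^δ` of all finite induced subgraphs of `P^δ` (up to isomorphism). -/
def gridClass (δ : Triple) : GraphClass :=
  fun V G => Finite V ∧ Nonempty (G ↪g gridGraph δ)

/-! ### Clique-width -/

/-- Clique-width expressions with labels from `L`. -/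
inductive CWExpr (L : Type) : Type
  | vertex (i : L) : CWExpr L
  | addEdges (i j : L) (hij : i ≠ j) (τ : CWExpr L) : CWExpr L
  | relabel (i j : L) (τ : CWExpr L) : CWExpr L
  | union (σ τ : CWExpr L) : CWExpr L

/-- The vertices of the labelled graph constructed by an expression. -/
def CWExpr.Vert {L : Type} : CWExpr L → Type
  | .vertex _ => Unit
  | .addEdges _ _ _ τ => τ.Vert
  | .relabel _ _ τ => τ.Vert
  | .union σ τ => σ.Vert ⊕ τ.Vert

open Classical in
/-- The labels of the labelled graph constructed by an expression. -/
noncomputable def CWExpr.label {L : Type} : (τ : CWExpr L) → τ.Vert → L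
  | .vertex i => fun _ => i
  | .addEdges _ _ _ τ => τ.label
  | .relabel i j τ => fun v => if τ.label v = i then j else τ.label v
  | .union σ τ => Sum.elim σ.label τ.label

/-- The underlying graph of the labelled graph constructed by an expression. -/
noncomputable def CWExpr.graph {L : Type} : (τ : CWExpr L) → SimpleGraph τ.Vert
  | .vertex _ => (⊥ : SimpleGraph Unit)
  | .addEdges i j _ τ =>
      τ.graph ⊔ SimpleGraph.fromRel (fun u v => τ.label u = i ∧ τ.label v = j)
  | .relabel _ _ τ => τ.graph
  | .union σ τ => SimpleGraph.sum σ.graph τ.graph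

/-- The clique-width of a finite graph: the least number of labels in an expression that constructs
the graph. The empty graph, which no expression constructs, gets the value `0`. -/
noncomputable def cliqueWidth {V : Type} (G : SimpleGraph V) : ℕ :=
  sInf {k : ℕ | ∃ τ : CWExpr (Fin k), Nonempty (G ≃g τ.graph)}

/-- A class of finite graphs has unbounded clique-width. -/
def UnboundedCliqueWidth (C : GraphClass) : Prop :=
  ∀ k : ℕ, ∃ (V : Type) (G : SimpleGraph V), C V G ∧ k < cliqueWidth G

/-! ### The two-row neighbourhood parameter -/

/-- Two vertices of `U` are similar if they have the same neighbours outside `U`. -/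
def similarSetoid {V : Type} (G : SimpleGraph V) (U : Set V) : Setoid U where
  r u u' := ∀ w : V, w ∉ U → (G.Adj u w ↔ G.Adj u' w)
  iseqv :=
    { refl := fun _ _ _ => Iff.rfl
      symm := fun h w hw => (h w hw).symm
      trans := fun h h' w hw => (h w hw).trans (h' w hw) }

/-- `μ(G, U)`: the number of similarity classes of `U` in `G` (for finite `U`). -/
noncomputable def mu {V : Type} (G : SimpleGraph V) (U : Set V) : ℕ :=
  Nat.card (Quotient (similarSetoid G U))

/-- The vertices of the first two rows in the columns of `Q`. -/
def twoRows (Q : Finset ℕ) : Set (ℕ × ℕ) :=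
  {v | v.1 ∈ Q ∧ (v.2 = 0 ∨ v.2 = 1)}

/-- The two-row graph `T^δ(Q)`. -/
def twoRowGraph (δ : Triple) (Q : Finset ℕ) : SimpleGraph (twoRows Q) :=
  (gridGraph δ).induce (twoRows Q)

/-- The first row, as a set of vertices of the two-row graph. -/
def firstRow (Q : Finset ℕ) : Set (twoRows Q) :=
  {v | v.1.2 = 0}

/-- `N^δ(Q)`. -/
noncomputable def nbhdParam (δ : Triple) (Q : Finset ℕ) : ℕ :=
  mu (twoRowGraph δ Q) (firstRow Q)

/-- `N^δ` is unbounded: for some fixed `j`, the numbers `N^δ([j, n])` are unbounded as `n → ∞`. -/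
def NbhdParamUnbounded (δ : Triple) : Prop :=
  ∃ j : ℕ, ∀ N : ℕ, ∃ n : ℕ, N < nbhdParam δ (Finset.Icc j n)

end GridCW

namespace GridCW

/-! ### Adjacency in the grid graph -/

/-! Whether two vertices in different rows are adjacent depends only on their columns and on which
one lies lower; in one row the same rule holds unless the columns are consecutive. So the two-row
graph governs nearly all adjacencies.

If the parameter is bounded by N, list the vertices of a finite subgraph row by row, left to right.
Each new vertex sees all earlier ones, except its immediate predecessor, according to the similarity
class of their column. Adding vertices in this order takes N + 2 labels: the classes, one for the
predecessor, one for the newcomer (`exists_builds_of_linearOrder`).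

Conversely, an expression with k labels yields a set U of between t and 2t vertices with at most k
neighbourhoods outside U (`CWExpr.hasBalancedSet`). Take a grid of 3K rows on columns Q, with t =
|Q|K. If U has a horizontal boundary in at least K rows, many of these lie at one place, and the
link there separates their endpoints in U. Otherwise U contains one row and misses another, so the
parameter on Q is at most 2^k (`nbhdParam_le_of_rows`). -/

theorem linkAdj_of_lt (a : Fin 4) {j k : ℕ} (h : j < k) : linkAdj a j k ↔ linkAdj a 0 1 := by
  fin_cases a <;> simp [linkAdj] <;> omega

theorem linkAdj_of_gt (a : Fin 4) {j k : ℕ} (h : j < k) : linkAdj a k j ↔ linkAdj a 1 0 := by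
  fin_cases a <;> simp [linkAdj] <;> omega

/-- Under every letter, the vertex of the next column in the higher-numbered row separates two
vertices of a column. -/
theorem linkAdj_left_ne (a : Fin 4) {r s : ℕ} (h : r < s) :
    ¬ (linkAdj a r s ↔ linkAdj a s s) := by
  fin_cases a <;> simp [linkAdj] <;> omega

theorem linkAdj_right_ne (a : Fin 4) {r s : ℕ} (h : r < s) :
    ¬ (linkAdj a r r ↔ linkAdj a r s) := by
  fin_cases a <;> simp [linkAdj] <;> omega

theorem BondSet.not_mem_succ (β : BondSet) (i : ℕ) : (i, i + 1) ∉ β.carrier := by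
  intro h
  have := β.separated _ _ h
  simp at this

theorem BondSet.not_mem_succ' (β : BondSet) (i : ℕ) : (i + 1, i) ∉ β.carrier := by
  intro h
  exact β.not_mem_succ i (β.symm _ _ h)

theorem gridGraph_adj_of_row_lt (δ : Triple) (i i' : ℕ) {j k : ℕ} (h : j < k) :
    (gridGraph δ).Adj (i, j) (i', k) ↔ (gridGraph δ).Adj (i, 0) (i', 1) := by
  have h' : j ≠ k := h.ne
  simp [gridGraph, SimpleGraph.fromRel_adj, gridRel, linkAdj_of_lt _ h, linkAdj_of_gt _ h, h']

/-- Columns that are distinct and not consecutive are joined only by bonds, which ignore rows. -/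
theorem gridGraph_adj_of_same_row (δ : Triple) {i i' : ℕ} (r : ℕ) (h : i + 1 < i') :
    (gridGraph δ).Adj (i, r) (i', r) ↔ (gridGraph δ).Adj (i, 0) (i', 1) := by
  have h1 : i ≠ i' := by omega
  have h2 : i' ≠ i + 1 := by omega
  have h3 : i ≠ i' + 1 := by omega
  simp [gridGraph, SimpleGraph.fromRel_adj, gridRel, h1, h1.symm, h2, h3]

theorem gridGraph_adj_succ (δ : Triple) (i j k : ℕ) :
    (gridGraph δ).Adj (i, j) (i + 1, k) ↔ linkAdj (δ.α i) j k := by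
  simp [gridGraph, SimpleGraph.fromRel_adj, gridRel, BondSet.not_mem_succ,
    BondSet.not_mem_succ']
  omega

/-! ### The two-row parameter -/

theorem nbhdParam_le_of_map (δ : Triple) (Q : Finset ℕ) {X : Type} [Finite X] (g : ℕ → X)
    (hg : ∀ i ∈ Q, ∀ i' ∈ Q, g i = g i' → ∀ c ∈ Q,
      ((gridGraph δ).Adj (i, 0) (c, 1) ↔ (gridGraph δ).Adj (i', 0) (c, 1))) :
    nbhdParam δ Q ≤ Nat.card X := by
  apply Nat.card_le_card_of_injective
    (fun a : Quotient (similarSetoid (twoRowGraph δ Q) (firstRow Q)) => g a.out.1.1.1)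
  intro a b hab
  rw [← Quotient.out_equiv_out]
  rintro ⟨⟨c, d⟩, hc, hd⟩ hw
  have hd1 : d = 1 := by
    rcases hd with hd | hd
    · exact absurd hd hw
    · exact hd
  subst hd1
  change g a.out.1.1.1 = g b.out.1.1.1 at hab
  revert hab
  obtain ⟨⟨⟨i, i0⟩, hi⟩, hi'⟩ := a.out
  obtain ⟨⟨⟨i', i0'⟩, hj⟩, hj'⟩ := b.out
  intro hab
  obtain rfl : i0 = 0 := hi'
  obtain rfl : i0' = 0 := hj'
  exact hg i hi.1 i' hj.1 hab c hc

theorem exists_map_of_nbhdParam_le (δ : Triple) (Q : Finset ℕ) {N : ℕ}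
    (h : nbhdParam δ Q ≤ N) :
    ∃ g : Q → Fin N, ∀ i i' : Q, g i = g i' → ∀ c ∈ Q,
      ((gridGraph δ).Adj (i, 0) (c, 1) ↔ (gridGraph δ).Adj (i', 0) (c, 1)) := by
  have : Finite (twoRows Q) := by
    apply Set.Finite.to_subtype
    apply (Q ×ˢ ({0, 1} : Finset ℕ)).finite_toSet.subset
    rintro ⟨a, b⟩ ⟨h1, h2⟩
    simpa using And.intro h1 h2
  let e := Finite.equivFin (Quotient (similarSetoid (twoRowGraph δ Q) (firstRow Q)))
  let v : Q → firstRow Q := fun i => ⟨⟨(i, 0), i.2, Or.inl rfl⟩, rfl⟩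
  refine ⟨fun i => Fin.castLE h (e ⟦v i⟧), fun i i' hii c hc => ?_⟩
  have h1 := e.injective (Fin.castLE_injective h hii)
  exact Quotient.exact h1 ⟨(c, 1), hc, Or.inr rfl⟩ (by simp [firstRow])

/-! ### Building graphs by expressions -/

/-- The expression `τ` constructs the vertex set `s` with the adjacency `R` and the labels `lab`. -/
def CWExpr.Builds {L V : Type} (τ : CWExpr L) (s : Set V) (R : V → V → Prop) (lab : V → L) :
    Prop :=
  ∃ e : τ.Vert → V, Function.Injective e ∧ Set.range e = s ∧
    (∀ x, lab (e x) = τ.label x) ∧ ∀ x y, τ.graph.Adj x y ↔ R (e x) (e y)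

theorem CWExpr.addEdges_graph_adj {L : Type} {i j : L} (hij : i ≠ j) {τ : CWExpr L}
    (x y : τ.Vert) : (CWExpr.addEdges i j hij τ).graph.Adj x y ↔ τ.graph.Adj x y ∨
      x ≠ y ∧ (τ.label x = i ∧ τ.label y = j ∨ τ.label y = i ∧ τ.label x = j) :=
  Iff.rfl

namespace CWExpr.Builds

variable {L V : Type} {s : Set V} {R R' : V → V → Prop} {lab lab' : V → L}

theorem congr {τ : CWExpr L} (h : τ.Builds s R lab) (hR : ∀ x ∈ s, ∀ y ∈ s, R x y ↔ R' x y)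
    (hl : ∀ x ∈ s, lab x = lab' x) : τ.Builds s R' lab' := by
  obtain ⟨e, he, rfl, h1, h2⟩ := h
  refine ⟨e, he, rfl, fun x => ?_, fun x y => ?_⟩
  · rw [← hl _ ⟨x, rfl⟩, h1]
  · rw [h2, hR _ ⟨x, rfl⟩ _ ⟨y, rfl⟩]

theorem vertex (a : V) (hR : ¬ R a a) : (CWExpr.vertex (lab a)).Builds {a} R lab := by
  refine ⟨fun _ => a, fun _ _ _ => rfl, ?_, fun _ => rfl, fun x y => ?_⟩
  · have : Nonempty (CWExpr.vertex (lab a)).Vert := ⟨()⟩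
    exact Set.range_const
  · exact iff_of_false (fun h => h) hR

theorem insert {τ : CWExpr L} (h : τ.Builds s R lab) {a : V} (ha : a ∉ s)
    (hR : ∀ x, ¬ R a x ∧ ¬ R x a) :
    (CWExpr.union τ (CWExpr.vertex (lab a))).Builds (Insert.insert a s) R lab := by
  obtain ⟨e, he, rfl, h1, h2⟩ := h
  have hne : ∀ x, e x ≠ a := fun x hx => ha ⟨x, hx⟩
  refine ⟨Sum.elim e (fun _ => a), ?_, ?_, ?_, ?_⟩
  · exact he.sumElim (fun _ _ _ => rfl) (fun x _ => hne x)
  · ext x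
    constructor
    · rintro ⟨y | y, rfl⟩
      · exact Or.inr ⟨y, rfl⟩
      · exact Or.inl rfl
    · rintro (rfl | ⟨y, rfl⟩)
      · exact ⟨Sum.inr (), rfl⟩
      · exact ⟨Sum.inl y, rfl⟩
  · rintro (x | x)
    · exact h1 x
    · rfl
  · rintro (x | x) (y | y)
    · exact h2 x y
    · exact iff_of_false (by rintro ⟨⟩) (hR _).2
    · exact iff_of_false (by rintro ⟨⟩) (hR _).1
    · exact iff_of_false (fun h => h) (hR _).1

theorem addEdges {τ : CWExpr L} (h : τ.Builds s R lab) {i j : L} (hij : i ≠ j) :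
    (CWExpr.addEdges i j hij τ).Builds s
      (fun x y => R x y ∨ (lab x = i ∧ lab y = j) ∨ (lab y = i ∧ lab x = j)) lab := by
  obtain ⟨e, he, hs, h1, h2⟩ := h
  refine ⟨e, he, hs, h1, fun (x y : τ.Vert) => (CWExpr.addEdges_graph_adj hij x y).trans ?_⟩
  beta_reduce
  rw [h1 x, h1 y, h2]
  constructor
  · tauto
  · rintro (h | h | h)
    · exact Or.inl h
    · refine Or.inr ⟨?_, Or.inl h⟩
      rintro rfl
      exact hij (h.1.symm.trans h.2)
    · refine Or.inr ⟨?_, Or.inr h⟩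
      rintro rfl
      exact hij (h.1.symm.trans h.2)

theorem exists_addEdges_finset [DecidableEq L] (h : ∃ τ : CWExpr L, τ.Builds s R lab) (i : L)
    (T : Finset L) (hT : i ∉ T) :
    ∃ τ : CWExpr L, τ.Builds s
      (fun x y => R x y ∨ (lab x = i ∧ lab y ∈ T) ∨ (lab y = i ∧ lab x ∈ T)) lab := by
  induction T using Finset.induction_on with
  | empty => simpa using h
  | insert j T _ ih =>
    rw [Finset.mem_insert, not_or] at hT
    obtain ⟨τ, hτ⟩ := ih hT.2
    refine ⟨_, (hτ.addEdges hT.1).congr (fun x _ y _ => ?_) (fun _ _ => rfl)⟩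
    simp only [Finset.mem_insert]
    tauto

open Classical in
theorem relabel {τ : CWExpr L} (h : τ.Builds s R lab) (i j : L) :
    (CWExpr.relabel i j τ).Builds s R (fun x => if lab x = i then j else lab x) := by
  obtain ⟨e, he, hs, h1, h2⟩ := h
  have key (x : τ.Vert) : (if lab (e x) = i then j else lab (e x)) =
      if τ.label x = i then j else τ.label x := by rw [h1]
  exact ⟨e, he, hs, key, h2⟩

end CWExpr.Builds

open Classical in
/-- If the vertices below `w`, apart from its immediate predecessor, are joined to `w` according to
their values under `f`, then two more labels than values suffice. -/
theorem exists_builds_of_linearOrder {V L : Type} [LinearOrder V] (G : SimpleGraph V)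
    (f : V → L) (last new : L) (hln : last ≠ new) (hfl : ∀ x, f x ≠ last) (hfn : ∀ x, f x ≠ new)
    (hf : ∀ x y x' y' w, x < y → y < w → x' < y' → y' < w → f x = f x' →
      (G.Adj x w ↔ G.Adj x' w)) (s : Finset V) (hs : s.Nonempty) :
    ∃ τ : CWExpr L, τ.Builds (s : Set V) G.Adj
      (fun x => if ∀ y ∈ s, y ≤ x then last else f x) := by
  induction s using Finset.induction_on_max with
  | empty => simp at hs
  | insert a s has ih =>
    clear hs
    have hane : ∀ x ∈ s, x ≠ a := fun x hx => (has x hx).ne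
    have ha : a ∉ s := fun h => hane a h rfl
    rcases s.eq_empty_or_nonempty with rfl | hs
    · rw [insert_empty_eq, Finset.coe_singleton]
      exact ⟨_, CWExpr.Builds.vertex a (G.loopless.irrefl a)⟩
    obtain ⟨τ, hτ⟩ := ih hs
    set m := s.max' hs
    have hmax : ∀ x ∈ s, (∀ y ∈ s, y ≤ x) ↔ x = m := fun x hx =>
      ⟨fun h => le_antisymm (s.le_max' x hx) (h _ (s.max'_mem hs)),
        fun h y hy => h ▸ s.le_max' y hy⟩
    have hlt : ∀ x ∈ s, x ≠ m → x < m := fun x hx h => lt_of_le_of_ne (s.le_max' x hx) h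
    have hms : m ∈ s := s.max'_mem hs
    have hma : m < a := has m hms
    let lab : V → L := fun x => if x = a then new else if x = m then last else f x
    -- Edges at `a` are suppressed so that `a` can enter as an isolated vertex.
    have hτ1 : τ.Builds (s : Set V) (fun x y => G.Adj x y ∧ x ≠ a ∧ y ≠ a) lab := by
      refine hτ.congr (fun x hx y hy => ?_) (fun x hx => ?_)
      · simp [hane x hx, hane y hy]
      · simp only [lab, hane x hx, hmax x hx, if_false]
    have hτ2 := hτ1.insert (a := a) (by simpa using ha) (by simp)
    let T : Finset L := (s.filter (fun x => G.Adj x a)).image lab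
    have hlabs : ∀ x ∈ s, lab x ≠ new := by
      intro x hx
      simp only [lab, hane x hx, if_false]
      split_ifs
      · exact hln
      · exact hfn x
    have hT : ∀ x ∈ s, lab x ∈ T ↔ G.Adj x a := by
      intro x hx
      refine ⟨fun h => ?_, fun h => Finset.mem_image_of_mem _ (by simp [hx, h])⟩
      obtain ⟨y, hy, hxy⟩ := Finset.mem_image.1 h
      obtain ⟨hy, hya⟩ := Finset.mem_filter.1 hy
      simp only [lab, hane x hx, hane y hy, if_false] at hxy
      split_ifs at hxy with h1 h2 h2
      · rwa [h2, ← h1]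
      · exact absurd hxy.symm (hfl x)
      · exact absurd hxy (hfl y)
      -- The current maximum `m` lies strictly between both vertices and `a`, as `hf` requires.
      · exact (hf y m x m a (hlt y hy h1) hma (hlt x hx h2) hma hxy).1 hya
    have hnT : new ∉ T := by
      intro h
      obtain ⟨y, hy, hxy⟩ := Finset.mem_image.1 h
      exact hlabs y (Finset.mem_filter.1 hy).1 hxy
    obtain ⟨τ3, hτ3⟩ := CWExpr.Builds.exists_addEdges_finset ⟨_, hτ2⟩ new T hnT
    rw [Finset.coe_insert]
    -- The old maximum must give up `last` before the newcomer receives it.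
    refine ⟨_, ((hτ3.relabel last (f m)).relabel new last).congr ?_ ?_⟩
    · have hla : lab a = new := by simp [lab]
      rintro x (rfl | hx) y (rfl | hy)
      · simp [hla, hnT]
      · simp [hla, hT y hy, hlabs y hy, G.adj_comm]
      · simp [hla, hT x hx, hlabs x hx]
      · simp [hane x hx, hane y hy, hlabs x hx, hlabs y hy]
    · rintro x (rfl | hx)
      · have : ∀ y ∈ insert x s, y ≤ x := by
          rw [Finset.forall_mem_insert]
          exact ⟨le_rfl, fun y hy => (has y hy).le⟩
        rw [if_pos this]
        simp [lab, hln.symm]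
      · have : ¬ ∀ y ∈ insert a s, y ≤ x := fun h =>
          absurd (has x hx) (not_lt.2 (h a (Finset.mem_insert_self _ _)))
        simp only [this, if_false, lab, hane x hx]
        split_ifs <;> simp_all

theorem exists_expr_of_linearOrder {V : Type} [Finite V] [Nonempty V] [LinearOrder V]
    (G : SimpleGraph V) {N : ℕ} (f : V → Fin N)
    (hf : ∀ x y x' y' w, x < y → y < w → x' < y' → y' < w → f x = f x' →
      (G.Adj x w ↔ G.Adj x' w)) :
    ∃ τ : CWExpr (Fin (N + 2)), Nonempty (G ≃g τ.graph) := by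
  have := Fintype.ofFinite V
  obtain ⟨τ, e, he, hs, -, h2⟩ := exists_builds_of_linearOrder G
    (fun x => Fin.castAdd 2 (f x)) (Fin.natAdd N 0) (Fin.natAdd N 1)
    (by simp [Fin.ext_iff])
    (fun x h => by have := congrArg Fin.val h; simp at this; omega)
    (fun x h => by have := congrArg Fin.val h; simp at this; omega)
    (fun x y x' y' w h1 h2 h3 h4 h5 => hf x y x' y' w h1 h2 h3 h4
      (Fin.castAdd_injective _ _ h5))
    Finset.univ Finset.univ_nonempty
  have hb : Function.Bijective e := ⟨he, Set.range_eq_univ.1 (by simpa using hs)⟩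
  let i : τ.graph ≃g G := ⟨Equiv.ofBijective e hb, fun {x y} => (h2 x y).symm⟩
  exact ⟨τ, ⟨i.symm⟩⟩

/-- Ensures that the infimum defining clique-width is attained and is not the default 0 of an empty
set. -/
theorem exists_expr {V : Type} [Finite V] [Nonempty V] (G : SimpleGraph V) :
    ∃ k, ∃ τ : CWExpr (Fin k), Nonempty (G ≃g τ.graph) := by
  let e := Finite.equivFin V
  let : LinearOrder V := LinearOrder.lift' e e.injective
  exact ⟨_, exists_expr_of_linearOrder G e fun x y x' y' w _ _ _ _ h => by
    rw [e.injective h]⟩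

/-! ### A bounded parameter gives bounded clique-width -/

theorem cliqueWidth_le_of_embedding (δ : Triple) {V : Type} [Finite V] {G : SimpleGraph V}
    (φ : G ↪g gridGraph δ) {N : ℕ} (hN : ∀ n, nbhdParam δ (Finset.Icc 0 n) ≤ N) :
    cliqueWidth G ≤ N + 2 := by
  rcases isEmpty_or_nonempty V with hV | hV
  · have h0 : {k : ℕ | ∃ τ : CWExpr (Fin k), Nonempty (G ≃g τ.graph)} = ∅ := by
      ext k
      simp only [Set.mem_ofPred_eq, Set.mem_empty_iff_false, iff_false]
      rintro ⟨τ, ⟨i⟩⟩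
      have : ∀ {k} (τ : CWExpr (Fin k)), Nonempty τ.Vert := by
        intro k τ
        induction τ with
        | vertex => exact ⟨()⟩
        | addEdges _ _ _ _ ih => exact ih
        | relabel _ _ _ ih => exact ih
        | union _ _ ih _ => exact ih.map Sum.inl
      exact hV.elim (i.symm (this τ).some)
    simp [cliqueWidth, h0]
  have := Fintype.ofFinite V
  let n := Finset.univ.sup fun v => (φ v).1
  have hn : ∀ v, (φ v).1 ∈ Finset.Icc 0 n := fun v =>
    Finset.mem_Icc.2 ⟨Nat.zero_le _, Finset.le_sup (f := fun v => (φ v).1) (Finset.mem_univ v)⟩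
  obtain ⟨g, hg⟩ := exists_map_of_nbhdParam_le δ _ (hN n)
  let key : V → ℕ ×ₗ ℕ := fun v => toLex ((φ v).2, (φ v).1)
  have hkey : Function.Injective key := by
    intro v w h
    apply φ.injective
    have := toLex.injective h
    rw [Prod.mk.injEq] at this
    exact Prod.ext this.2 this.1
  let : LinearOrder V := LinearOrder.lift' key hkey
  have hlt : ∀ v w : V, v < w ↔
      (φ v).2 < (φ w).2 ∨ (φ v).2 = (φ w).2 ∧ (φ v).1 < (φ w).1 := by
    intro v w
    change key v < key w ↔ _
    rw [Prod.Lex.lt_iff]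
    rfl
  have hadj : ∀ x y w : V, x < y → y < w →
      (G.Adj x w ↔ (gridGraph δ).Adj ((φ x).1, 0) ((φ w).1, 1)) := by
    intro x y w hxy hyw
    rw [← φ.map_adj_iff]
    -- If x and w share a row, then y lies between them in that row, so their columns are not
    -- consecutive.
    have : (φ x).2 < (φ w).2 ∨ (φ x).2 = (φ w).2 ∧ (φ x).1 + 1 < (φ w).1 := by
      rw [hlt] at hxy hyw
      omega
    rcases this with h | ⟨h, h'⟩
    · exact gridGraph_adj_of_row_lt δ (φ x).1 (φ w).1 h
    · have := gridGraph_adj_of_same_row δ (φ x).2 h'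
      nth_rw 2 [h] at this
      exact this
  apply Nat.sInf_le
  refine exists_expr_of_linearOrder G (fun v => g ⟨_, hn v⟩) fun x y x' y' w h1 h2 h3 h4 h5 => ?_
  rw [hadj x y w h1 h2, hadj x' y' w h3 h4]
  exact hg _ _ h5 _ (hn w)

/-! ### An unbounded parameter gives unbounded clique-width -/

instance CWExpr.finite_vert {L : Type} (τ : CWExpr L) : Finite τ.Vert := by
  induction τ with
  | vertex => exact inferInstanceAs (Finite Unit)
  | addEdges _ _ _ _ ih => exact ih
  | relabel _ _ _ ih => exact ih
  | union σ τ ih1 ih2 => exact inferInstanceAs (Finite (σ.Vert ⊕ τ.Vert))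

/-- There is a set of at least `t` and fewer than `2 * t` vertices whose labels, and whose
neighbourhoods outside the set, are determined by values in `L`. -/
def CWExpr.HasBalancedSet {L : Type} (τ : CWExpr L) (t : ℕ) : Prop :=
  ∃ (U : Set τ.Vert) (f : τ.Vert → L), t ≤ U.ncard ∧ U.ncard < 2 * t ∧
    (∀ u ∈ U, ∀ u' ∈ U, f u = f u' → τ.label u = τ.label u') ∧
    (∀ u ∈ U, ∀ u' ∈ U, f u = f u' → ∀ w ∉ U, (τ.graph.Adj u w ↔ τ.graph.Adj u' w))

namespace CWExpr.HasBalancedSet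

variable {L : Type} {σ τ : CWExpr L} {t : ℕ}

theorem of_card_lt (h : t ≤ Nat.card τ.Vert) (hlt : Nat.card τ.Vert < 2 * t) :
    τ.HasBalancedSet t :=
  ⟨Set.univ, τ.label, by simpa using h, by simpa using hlt, fun _ _ _ _ h => h,
    fun _ _ _ _ _ w hw => absurd (Set.mem_univ w) hw⟩

/-- Vertices of U with equal `f` have equal labels, so every later edge operation treats them alike.
Keeping `f` apart from the labels lets relabelling merge labels without losing this. -/
theorem addEdges {i j : L} (hij : i ≠ j) (h : τ.HasBalancedSet t) :
    (CWExpr.addEdges i j hij τ).HasBalancedSet t := by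
  obtain ⟨U, f, h1, h2, h3, h4⟩ := h
  refine ⟨U, f, h1, h2, h3, fun (u : τ.Vert) hu (u' : τ.Vert) hu' h (w : τ.Vert) hw => ?_⟩
  refine (addEdges_graph_adj (τ := τ) hij u w).trans
    (Iff.trans ?_ (addEdges_graph_adj (τ := τ) hij u' w).symm)
  have hu1 : u ≠ w := fun h => hw (h ▸ hu)
  have hu2 : u' ≠ w := fun h => hw (h ▸ hu')
  rw [h3 u hu u' hu' h, h4 u hu u' hu' h w hw]
  simp only [hu1, hu2, ne_eq, not_false_eq_true]

theorem relabel (i j : L) (h : τ.HasBalancedSet t) : (CWExpr.relabel i j τ).HasBalancedSet t := by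
  classical
  obtain ⟨U, f, h1, h2, h3, h4⟩ := h
  have key (u : τ.Vert) (hu : u ∈ U) (u' : τ.Vert) (hu' : u' ∈ U) (h : f u = f u') :
      (if τ.label u = i then j else τ.label u) = if τ.label u' = i then j else τ.label u' := by
    rw [h3 u hu u' hu' h]
  exact ⟨U, f, h1, h2, key, h4⟩

theorem union_left (h : σ.HasBalancedSet t) : (CWExpr.union σ τ).HasBalancedSet t := by
  obtain ⟨U, f, h1, h2, h3, h4⟩ := h
  have hU : (Sum.inl '' U : Set (σ.Vert ⊕ τ.Vert)).ncard = U.ncard :=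
    Set.ncard_image_of_injective _ Sum.inl_injective
  refine ⟨(Sum.inl '' U : Set (σ.Vert ⊕ τ.Vert)), Sum.elim f τ.label, h1.trans_eq hU.symm,
    hU.trans_lt h2, ?_, ?_⟩
  · rintro _ ⟨u, hu, rfl⟩ _ ⟨u', hu', rfl⟩ h
    exact h3 u hu u' hu' h
  · rintro _ ⟨u, hu, rfl⟩ _ ⟨u', hu', rfl⟩ h (w | w) hw
    · exact h4 u hu u' hu' h w fun hwU => hw ⟨w, hwU, rfl⟩
    · exact iff_of_false (by rintro ⟨⟩) (by rintro ⟨⟩)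

theorem union_right (h : τ.HasBalancedSet t) : (CWExpr.union σ τ).HasBalancedSet t := by
  obtain ⟨U, f, h1, h2, h3, h4⟩ := h
  have hU : (Sum.inr '' U : Set (σ.Vert ⊕ τ.Vert)).ncard = U.ncard :=
    Set.ncard_image_of_injective _ Sum.inr_injective
  refine ⟨(Sum.inr '' U : Set (σ.Vert ⊕ τ.Vert)), Sum.elim σ.label f, h1.trans_eq hU.symm,
    hU.trans_lt h2, ?_, ?_⟩
  · rintro _ ⟨u, hu, rfl⟩ _ ⟨u', hu', rfl⟩ h
    exact h3 u hu u' hu' h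
  · rintro _ ⟨u, hu, rfl⟩ _ ⟨u', hu', rfl⟩ h (w | w) hw
    · exact iff_of_false (by rintro ⟨⟩) (by rintro ⟨⟩)
    · exact h4 u hu u' hu' h w fun hwU => hw ⟨w, hwU, rfl⟩

end CWExpr.HasBalancedSet

/-- Descend into an operand with at least t vertices until fewer than 2t remain: a union of at least
2t vertices always has such an operand. -/
theorem CWExpr.hasBalancedSet {L : Type} (τ : CWExpr L) {t : ℕ} (ht : 1 ≤ t)
    (hτ : t ≤ Nat.card τ.Vert) : τ.HasBalancedSet t := by
  by_cases hlt : Nat.card τ.Vert < 2 * t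
  · exact .of_card_lt hτ hlt
  induction τ with
  | vertex i =>
    have : Nat.card (CWExpr.vertex i).Vert = 1 := Nat.card_unique (α := Unit)
    omega
  | addEdges i j hij τ ih => exact (ih hτ hlt).addEdges hij
  | relabel i j τ ih => exact (ih hτ hlt).relabel i j
  | union σ τ ih1 ih2 =>
    have hcard : Nat.card (CWExpr.union σ τ).Vert = Nat.card σ.Vert + Nat.card τ.Vert :=
      Nat.card_sum (α := σ.Vert) (β := τ.Vert)
    by_cases h1 : t ≤ Nat.card σ.Vert
    · by_cases hlt1 : Nat.card σ.Vert < 2 * t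
      · exact .union_left (.of_card_lt h1 hlt1)
      · exact .union_left (ih1 h1 hlt1)
    · have h2 : t ≤ Nat.card τ.Vert := by omega
      by_cases hlt2 : Nat.card τ.Vert < 2 * t
      · exact .union_right (.of_card_lt h2 hlt2)
      · exact .union_right (ih2 h2 hlt2)

theorem exists_balanced_of_cliqueWidth_le {V : Type} [Finite V] [Nonempty V]
    (G : SimpleGraph V) {k t : ℕ} (hk : cliqueWidth G ≤ k) (ht : 1 ≤ t) (htV : t ≤ Nat.card V) :
    ∃ (U : Set V) (f : V → Fin k), t ≤ U.ncard ∧ U.ncard < 2 * t ∧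
      ∀ u ∈ U, ∀ u' ∈ U, f u = f u' → ∀ w ∉ U, (G.Adj u w ↔ G.Adj u' w) := by
  obtain ⟨τ, ⟨φ⟩⟩ : cliqueWidth G ∈ {k | ∃ τ : CWExpr (Fin k), Nonempty (G ≃g τ.graph)} :=
    Nat.sInf_mem (exists_expr G)
  obtain ⟨U, f, h1, h2, -, h4⟩ := τ.hasBalancedSet ht (by rwa [← Nat.card_congr φ.toEquiv])
  have hU : (φ ⁻¹' U).ncard = U.ncard := by
    rw [← Set.ncard_image_of_injective _ φ.injective, Set.image_preimage_eq _ φ.surjective]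
  refine ⟨φ ⁻¹' U, fun v => Fin.castLE hk (f (φ v)), by rwa [hU], by rwa [hU],
    fun u hu u' hu' h w hw => ?_⟩
  rw [← φ.map_adj_iff, ← φ.map_adj_iff (v := u')]
  exact h4 _ hu _ hu' (Fin.castLE_injective hk h) _ hw

/-- A balanced set in a grid either meets the complement horizontally in many rows or contains
one row and misses another. -/
theorem exists_rows_of_balanced {j n K : ℕ} {U : Finset (ℕ × ℕ)}
    (hU : U ⊆ Finset.Icc j n ×ˢ Finset.range (3 * K))
    (h1 : (Finset.Icc j n).card * K ≤ U.card) (h2 : U.card < 2 * ((Finset.Icc j n).card * K))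
    {S : Finset ℕ}
    (hS : ∀ r < 3 * K, r ∉ S → ∀ i, j ≤ i → i + 1 ≤ n → ((i, r) ∈ U ↔ (i + 1, r) ∈ U))
    (hSK : S.card < K) :
    ∃ r < 3 * K, ∃ s < 3 * K, (∀ i ∈ Finset.Icc j n, (i, r) ∈ U) ∧
      ∀ i ∈ Finset.Icc j n, (i, s) ∉ U := by
  have hmono : ∀ r < 3 * K, r ∉ S → ∀ i ∈ Finset.Icc j n, ((j, r) ∈ U ↔ (i, r) ∈ U) := by
    intro r hr hrS i hi
    obtain ⟨hji, hin⟩ := Finset.mem_Icc.1 hi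
    clear hi
    induction i, hji using Nat.le_induction with
    | base => rfl
    | succ i hji ih => exact (ih (by omega)).trans (hS r hr hrS i hji hin)
  have hq : 0 < (Finset.Icc j n).card := by
    by_contra h
    have h0 : (Finset.Icc j n).card = 0 := by omega
    simp [h0] at h2
  -- Otherwise U lies in the fewer than K rows of `S` and is too small.
  have hred : ∃ r < 3 * K, r ∉ S ∧ (j, r) ∈ U := by
    by_contra! h
    have : U ⊆ Finset.Icc j n ×ˢ S := by
      rintro ⟨i, r⟩ hir
      obtain ⟨hi, hr⟩ := Finset.mem_product.1 (hU hir)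
      rw [Finset.mem_range] at hr
      refine Finset.mem_product.2 ⟨hi, ?_⟩
      by_contra hrS
      exact h r hr hrS ((hmono r hr hrS i hi).2 hir)
    have := Finset.card_le_card this
    rw [Finset.card_product] at this
    have := Nat.mul_lt_mul_of_pos_left hSK hq
    omega
  -- Otherwise U contains more than 2K full rows and is too large.
  have hblue : ∃ s < 3 * K, s ∉ S ∧ (j, s) ∉ U := by
    by_contra! h
    have : Finset.Icc j n ×ˢ (Finset.range (3 * K) \ S) ⊆ U := by
      rintro ⟨i, r⟩ hir
      obtain ⟨hi, hr⟩ := Finset.mem_product.1 hir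
      obtain ⟨hr, hrS⟩ := Finset.mem_sdiff.1 hr
      rw [Finset.mem_range] at hr
      exact (hmono r hr hrS i hi).1 (h r hr hrS)
    have := Finset.card_le_card this
    rw [Finset.card_product] at this
    have h3 := Finset.le_card_sdiff S (Finset.range (3 * K))
    rw [Finset.card_range] at h3
    have h4 := Nat.mul_le_mul_left (Finset.Icc j n).card
      (show 2 * K ≤ (Finset.range (3 * K) \ S).card by omega)
    rw [Nat.mul_left_comm] at h4
    omega
  obtain ⟨r, hr, hrS, hrU⟩ := hred
  obtain ⟨s, hs, hsS, hsU⟩ := hblue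
  exact ⟨r, hr, s, hs, fun i hi => (hmono r hr hrS i hi).1 hrU,
    fun i hi h => hsU ((hmono s hs hsS i hi).2 h)⟩

theorem card_le_of_forall_lt_ne {k : ℕ} (T : Finset ℕ) (g : ℕ → Fin k)
    (h : ∀ r ∈ T, ∀ s ∈ T, r < s → g r ≠ g s) : T.card ≤ k := by
  rw [← Finset.card_fin k]
  refine Finset.card_le_card_of_injOn g (fun _ _ => Finset.mem_univ _) fun r hr s hs hrs => ?_
  rcases lt_trichotomy r s with hlt | heq | hlt
  · exact absurd hrs (h r hr s hs hlt)
  · exact heq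
  · exact absurd hrs.symm (h s hs r hr hlt)

/-- A set that contains one row of a grid and misses another has many similarity classes. -/
theorem nbhdParam_le_of_rows (δ : Triple) {Q : Finset ℕ} {k r s : ℕ} (hrs : r ≠ s)
    (f : ℕ → Fin k) (hf : ∀ i ∈ Q, ∀ i' ∈ Q, f i = f i' → ∀ c ∈ Q,
      ((gridGraph δ).Adj (i, r) (c, s) ↔ (gridGraph δ).Adj (i', r) (c, s))) :
    nbhdParam δ Q ≤ 2 ^ k := by
  rcases hrs.lt_or_gt with hlt | hlt
  · have := nbhdParam_le_of_map δ Q f fun i hi i' hi' h c hc => by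
      rw [← gridGraph_adj_of_row_lt δ i c hlt, ← gridGraph_adj_of_row_lt δ i' c hlt]
      exact hf i hi i' hi' h c hc
    rw [Nat.card_fin] at this
    exact this.trans Nat.lt_two_pow_self.le
  -- Here the row in U is the upper one, so `f` classifies second-row vertices. A first-row vertex
  -- is determined by the set of classes it meets, whence 2^k.
  · have hX : Nat.card (Fin k → Prop) = 2 ^ k := by simp
    rw [← hX]
    refine nbhdParam_le_of_map δ Q
      (fun i a => ∃ c ∈ Q, f c = a ∧ (gridGraph δ).Adj (c, r) (i, s)) fun i hi i' hi' h c hc => ?_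
    have key : ∀ i ∈ Q, (gridGraph δ).Adj (i, 0) (c, 1) ↔
        ∃ c' ∈ Q, f c' = f c ∧ (gridGraph δ).Adj (c', r) (i, s) := by
      intro i hi
      rw [← gridGraph_adj_of_row_lt δ i c hlt, SimpleGraph.adj_comm]
      refine ⟨fun h => ⟨c, hc, rfl, h⟩, ?_⟩
      rintro ⟨c', hc', hcc, h⟩
      exact (hf c' hc' c hc hcc i hi).1 h
    rw [key i hi, key i' hi']
    exact iff_of_eq (congrFun h (f c))

theorem exists_lt_cliqueWidth (δ : Triple) {j n k : ℕ}
    (h : 2 ^ k < nbhdParam δ (Finset.Icc j n)) :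
    ∃ (V : Type) (G : SimpleGraph V), gridClass δ V G ∧ k < cliqueWidth G := by
  classical
  set Q := Finset.Icc j n
  have hq : 0 < Q.card := by
    rw [Finset.card_pos, Finset.nonempty_iff_ne_empty]
    intro h0
    have := nbhdParam_le_of_map δ Q (X := Unit) (fun _ => ()) (by simp [h0])
    have := Nat.one_le_two_pow (n := k)
    rw [Nat.card_unique] at *
    omega
  -- With K rows and 2|Q| kinds of boundary, some kind occurs in more than k rows.
  obtain ⟨K, hK⟩ : ∃ K, K = (Q ×ˢ (Finset.univ : Finset Bool)).card * k + 1 := ⟨_, rfl⟩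
  let W : Finset (ℕ × ℕ) := Q ×ˢ Finset.range (3 * K)
  have hWcard : Nat.card W = Q.card * (3 * K) := by
    rw [Nat.card_eq_fintype_card, Fintype.card_coe, Finset.card_product, Finset.card_range]
  have hqK : 1 ≤ Q.card * K := Nat.mul_pos hq (hK ▸ Nat.succ_pos _)
  have : Nonempty W := (Nat.card_pos_iff.1 (by rw [hWcard, Nat.mul_left_comm]; omega)).1
  refine ⟨W, (gridGraph δ).induce (W : Set (ℕ × ℕ)),
    ⟨inferInstance, ⟨SimpleGraph.Embedding.induce _⟩⟩, ?_⟩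
  by_contra! hcw
  obtain ⟨U₀, f₀, h1, h2, h3⟩ := exists_balanced_of_cliqueWidth_le _ hcw hqK
    (hWcard ▸ by rw [Nat.mul_left_comm]; omega)
  let U : Finset (ℕ × ℕ) := U₀.toFinset.map (Function.Embedding.subtype _)
  have hUcard : U.card = U₀.ncard := by
    rw [Finset.card_map, Set.ncard_eq_toFinset_card']
  have hUW : U ⊆ W := by
    intro v hv
    obtain ⟨w, -, rfl⟩ := Finset.mem_map.1 hv
    exact w.2
  have hUU : ∀ v (hv : v ∈ W), v ∈ U ↔ (⟨v, hv⟩ : W) ∈ U₀ := by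
    intro v hv
    simp only [U, Finset.mem_map, Set.mem_toFinset, Function.Embedding.subtype_apply]
    exact ⟨fun ⟨w, hw, hwv⟩ => by subst hwv; exact hw, fun hv' => ⟨_, hv', rfl⟩⟩
  let f : ℕ × ℕ → Fin k := fun v => if hv : v ∈ W then f₀ ⟨v, hv⟩ else f₀ (Classical.arbitrary W)
  have hf : ∀ u ∈ U, ∀ u' ∈ U, f u = f u' → ∀ w ∈ W, w ∉ U →
      ((gridGraph δ).Adj u w ↔ (gridGraph δ).Adj u' w) := by
    intro u hu u' hu' hff w hw hwU
    have huW := hUW hu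
    have huW' := hUW hu'
    simp only [f, huW, huW', dif_pos] at hff
    exact h3 ⟨u, huW⟩ ((hUU u huW).1 hu) ⟨u', huW'⟩ ((hUU u' huW').1 hu') hff ⟨w, hw⟩
      (fun h => hwU ((hUU w hw).2 h))
  rw [← hUcard] at h1 h2
  -- Row `r` crosses the boundary of U just after column `p.1`; the Boolean tells whether the left
  -- end is in U.
  let P : ℕ → ℕ × Bool → Prop := fun r p => p.1 ∈ Q ∧ p.1 + 1 ∈ Q ∧
    (p.2 = true ∧ (p.1, r) ∈ U ∧ (p.1 + 1, r) ∉ U ∨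
      p.2 = false ∧ (p.1, r) ∉ U ∧ (p.1 + 1, r) ∈ U)
  let S : Finset ℕ := (Finset.range (3 * K)).filter fun r => ∃ p, P r p
  rcases lt_or_ge S.card K with hSK | hSK
  · obtain ⟨r, hr, s, hs, hrU, hsU⟩ := exists_rows_of_balanced hUW h1 h2 (S := S) (by
      intro r hr hrS i hji hin
      by_contra hne
      have hiQ : i ∈ Q := Finset.mem_Icc.2 ⟨hji, by omega⟩
      have hiQ' : i + 1 ∈ Q := Finset.mem_Icc.2 ⟨by omega, hin⟩
      refine hrS (Finset.mem_filter.2 ⟨Finset.mem_range.2 hr, ?_⟩)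
      by_cases hi : (i, r) ∈ U
      · exact ⟨(i, true), hiQ, hiQ', Or.inl ⟨rfl, hi, fun h => hne (iff_of_true hi h)⟩⟩
      · exact ⟨(i, false), hiQ, hiQ', Or.inr ⟨rfl, hi, by_contra fun h => hne (iff_of_false hi h)⟩⟩)
      hSK
    have hrs : r ≠ s := by
      rintro rfl
      obtain ⟨i, hi⟩ := Finset.card_pos.1 hq
      exact hsU i hi (hrU i hi)
    refine absurd (nbhdParam_le_of_rows δ hrs (fun i => f (i, r)) fun i hi i' hi' hii c hc =>
      hf _ (hrU i hi) _ (hrU i' hi') hii _ ?_ (hsU c hc)) (not_le.2 h)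
    exact Finset.mem_product.2 ⟨hc, Finset.mem_range.2 hs⟩
  · have hch : ∀ r ∈ S, ∃ p, P r p := fun r hr => (Finset.mem_filter.1 hr).2
    choose! p hp using hch
    obtain ⟨⟨i, b⟩, -, hb⟩ := Finset.exists_lt_card_fiber_of_mul_lt_card_of_maps_to
      (s := S) (t := Q ×ˢ (Finset.univ : Finset Bool)) (f := p) (n := k)
      (fun r hr => Finset.mem_product.2 ⟨(hp r hr).1, Finset.mem_univ _⟩) (by omega)
    refine absurd hb (not_lt.2 ?_)
    have hT : ∀ r ∈ S.filter (fun r => p r = (i, b)), r < 3 * K ∧ P r (i, b) := by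
      intro r hr
      obtain ⟨hrS, hrp⟩ := Finset.mem_filter.1 hr
      exact ⟨Finset.mem_range.1 (Finset.mem_filter.1 hrS).1, hrp ▸ hp r hrS⟩
    cases b with
    | true =>
      refine card_le_of_forall_lt_ne _ (fun r => f (i, r)) fun r hr s hs hrs hff => ?_
      obtain ⟨hr, hiQ, hiQ', ⟨-, hr1, hr2⟩ | ⟨h0, -⟩⟩ := hT r hr
      · obtain ⟨hs, -, -, ⟨-, hs1, hs2⟩ | ⟨h0, -⟩⟩ := hT s hs
        · have := hf _ hr1 _ hs1 hff (i + 1, s)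
            (Finset.mem_product.2 ⟨hiQ', Finset.mem_range.2 hs⟩) hs2
          rw [gridGraph_adj_succ, gridGraph_adj_succ] at this
          exact linkAdj_left_ne _ hrs this
        · cases h0
      · cases h0
    | false =>
      refine card_le_of_forall_lt_ne _ (fun r => f (i + 1, r)) fun r hr s hs hrs hff => ?_
      obtain ⟨hr, hiQ, hiQ', ⟨h0, -⟩ | ⟨-, hr1, hr2⟩⟩ := hT r hr
      · cases h0
      · obtain ⟨hs, -, -, ⟨h0, -⟩ | ⟨-, hs1, hs2⟩⟩ := hT s hs
        · cases h0
        · have := hf _ hr2 _ hs2 hff (i, r)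
            (Finset.mem_product.2 ⟨hiQ, Finset.mem_range.2 hr⟩) hr1
          rw [SimpleGraph.adj_comm, gridGraph_adj_succ, SimpleGraph.adj_comm,
            gridGraph_adj_succ] at this
          exact linkAdj_right_ne _ hrs this

end GridCW

theorem mainTheorem1 (δ : GridCW.Triple) :
    GridCW.UnboundedCliqueWidth (GridCW.gridClass δ) ↔ GridCW.NbhdParamUnbounded δ := by
  constructor
  · intro h
    by_contra hN
    simp only [GridCW.NbhdParamUnbounded, not_exists, not_forall, not_lt] at hN
    -- Starting at column 0 covers the columns of every finite subgraph.
    obtain ⟨N, hN⟩ := hN 0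
    obtain ⟨V, G, ⟨hV, ⟨φ⟩⟩, hG⟩ := h (N + 2)
    exact absurd (GridCW.cliqueWidth_le_of_embedding δ φ hN) (not_le.2 hG)
  · rintro ⟨j, hj⟩ k
    obtain ⟨n, hn⟩ := hj (2 ^ k)
    exact GridCW.exists_lt_cliqueWidth δ hn
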